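/- **Proposition 1.5 (Ultraviolet limit of the ground state energies).** Let $V:\mathbb{R}^3\to\mathbb{R}$, let $g\in\mathbb{R}$, let $\omega:\mathbb{R}^3\to[0,\infty)$ and $v:\mathbb{R}^3\to\mathbb{R}$ be measurable, and write $V_\pm=\max(\pm V,0)$. Let $H_V=-\Delta+V$ be the operator on $L^2(\mathbb{R}^3)$ defined by its quadratic form on $\mathcal{Q}_V=\{u\in H^1(\mathbb{R}^3):\int V_+|u|^2<\infty\}$, let $\mu_V=\inf\sigma(H_V)$, and put $\mathcal{U}=\{u\in\mathcal{Q}_V:\|u\|_{L^2}=1\}$ and $\mathcal{Z}_\omega=\{f:\mathbb{R}^3\to\mathbb{C}\text{ measurable}:\omega^{1/2}f\in L^2(\mathbb{R}^3)\}$. Assume: 1. there are $0\le a<1$ and $b\in\mathbb{R}$ such that $V_-|u|^2$ is integrable and $\int V_-|u|^2\le a\|\nabla u\|_{L^2}^2+b\|u\|_{L^2}^2$ for all $u\in H^1(\mathbb{R}^3)$; moreover $V=V_1+V_2$ almost everywhere with $V_1\ge 0$, $V_1\in L^1_{\mathrm{loc}}(\mathbb{R}^3)$, $V_2\in L^{3/2}_{\mathrm{loc}}(\mathbb{R}^3)$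 real-valued, $\lim_{|x|\to\infty}V_2(x)=0$, and $\mu_V<\mu_{V_1}$; 2. the function $W=g^2\omega^{-1}v^2$ (with $0/0=0$ and $c/0=\infty$ for $c>0$) is almost everywhere finite and equals $W_1+W_2$ almost everywhere, for some $W_1\in L^1(\mathbb{R}^3)$ and some $W_2\in L^{3,\infty}(\mathbb{R}^3)$, i.e. $W_2$ is measurable with $\sup_{t>0}t\,\lambda(\{|W_2|>t\})^{1/3}<\infty$, $\lambda$ being Lebesgue measure. For $(u,f)\in\mathcal{U}\times\mathcal{Z}_\omega$ let $$\mathcal{E}(u,f)=\int|\nabla u|^2\,dx+\int V|u|^2\,dx+\int\omega|f|^2\,dk+2g\,\mathrm{Re}\int v(k)f(k)\Big(\int e^{ik\cdot x}|u(x)|^2\,dx\Big)dk,$$ and for $\Lambda>0$ let $\mathcal{E}_\Lambda$ be the same functional with $v$ replaced by $v_\Lambda=v\,\mathbf{1}_{|k|\le\Lambda}$. Then, the infima being taken in $[-\infty,\infty]$, $$\inf_{(u,f)\in\mathcal{U}\times\mathcal{Z}_\omega}\mathcal{E}_\Lambda(u,f)\;\longrightarrow\;\inf_{(u,f)\in\mathcal{U}\times\mathcal{Z}_\omega}\mathcal{E}(u,f)\qquad\text{as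 }\Lambda\to\infty.$$ In particular, no existence of minimizers is assumed. -/

import Mathlib

open MeasureTheory Filter Topology
open scoped ENNReal LineDeriv

noncomputable section

namespace KGS

/-- Physical space, and momentum space: three-dimensional Euclidean space. -/
abbrev Space3 : Type := EuclideanSpace ℝ (Fin 3)

/-- The one-particle Hilbert space of square-integrable complex functions. -/
abbrev L2 : Type := Lp ℂ 2 (volume : Measure Space3)

/-! ### The Sobolev space of order one and the electronic Hamiltonian -/

/-- The Sobolev space `H¹`, as a set of square-integrable functions. -/
def H1 : Set L2 := {u | TemperedDistribution.MemSobolev 1 2 (u : TemperedDistribution Space3 ℂ)}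

/-- The `i`-th distributional partial derivative of `u`, as a square-integrable function
(meaningful as soon as `u` is in `H1`, see `weakPartial_spec`). -/
def weakPartial (i : Fin 3) (u : L2) : L2 :=
  Classical.epsilon fun g : L2 =>
    ∂_{(EuclideanSpace.single i 1 : Space3)} (u : TemperedDistribution Space3 ℂ)
      = (g : TemperedDistribution Space3 ℂ)

theorem weakPartial_spec {u : L2} (hu : u ∈ H1) (i : Fin 3) :
    ∂_{(EuclideanSpace.single i 1 : Space3)} (u : TemperedDistribution Space3 ℂ)
      = (weakPartial i u : TemperedDistribution Space3 ℂ) := by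
  have h : TemperedDistribution.MemSobolev (1 - 1) 2
      (∂_{(EuclideanSpace.single i 1 : Space3)} (u : TemperedDistribution Space3 ℂ)) :=
    TemperedDistribution.MemSobolev.lineDerivOp hu
  rw [sub_self] at h
  exact Classical.epsilon_spec (TemperedDistribution.memSobolev_zero_iff.mp h)

/-- The kinetic energy `∫ |∇u|²`. -/
def kinetic (u : L2) : ℝ := ∑ i : Fin 3, ‖weakPartial i u‖ ^ 2

/-- The form domain `Q_V`: those `u` in `H¹` with `∫ V₊ |u|² < ∞`. -/
def formDomain (V : Space3 → ℝ) : Set L2 :=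
  {u | u ∈ H1 ∧ Integrable fun x => max (V x) 0 * ‖u x‖ ^ 2}

/-- The sesquilinear form of `-Δ + V`. -/
def form (V : Space3 → ℝ) (φ u : L2) : ℂ :=
  (∑ i : Fin 3, inner ℂ (weakPartial i φ) (weakPartial i u))
    + ∫ x, (V x : ℂ) * (starRingEnd ℂ (φ x) * u x)

/-- The graph of the operator `H_V = -Δ + V` associated with its quadratic form: `(u, w)` belongs to
it when `u` is in the domain of `H_V` and `H_V u = w`. -/
def hamiltonianGraph (V : Space3 → ℝ) : Set (L2 × L2) :=
  {p | p.1 ∈ formDomain V ∧ ∀ φ ∈ formDomain V, form V φ p.1 = inner ℂ φ p.2}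

/-- The spectrum of `H_V`: the complex `z` for which `H_V - z` has no bounded everywhere defined
inverse `R`. -/
def hamiltonianSpectrum (V : Space3 → ℝ) : Set ℂ :=
  {z | ¬ ∃ R : L2 →L[ℂ] L2, ∀ u w : L2, (u, w + z • u) ∈ hamiltonianGraph V ↔ u = R w}

/-- The bottom `μ_V` of the spectrum of the (semi-bounded self-adjoint) operator `H_V`. -/
def spectralBottom (V : Space3 → ℝ) : EReal :=
  ⨅ z ∈ hamiltonianSpectrum V, (z.re : EReal)

/-- The conditions on the external potential `V`: its negative part is form bounded relative to
`-Δ` with bound less than one, and `V = V₁ + V₂` with `V₁ ≥ 0` locally integrable, `V₂` locally in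
`L^{3/2}` and vanishing at infinity, and a spectral gap `μ_V < μ_{V₁}`. -/
def PotentialCondition (V : Space3 → ℝ) : Prop :=
  (∃ a b : ℝ, 0 ≤ a ∧ a < 1 ∧ ∀ u ∈ H1,
      Integrable (fun x => max (-V x) 0 * ‖u x‖ ^ 2) ∧
      ∫ x, max (-V x) 0 * ‖u x‖ ^ 2 ≤ a * kinetic u + b * ‖u‖ ^ 2) ∧
  ∃ V₁ V₂ : Space3 → ℝ,
    (∀ᵐ x, V x = V₁ x + V₂ x) ∧
    (∀ x, 0 ≤ V₁ x) ∧ LocallyIntegrable V₁ ∧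
    (∀ K : Set Space3, IsCompact K → MemLp V₂ (3 / 2) (volume.restrict K)) ∧
    Tendsto V₂ (cocompact Space3) (𝓝 0) ∧
    spectralBottom V < spectralBottom V₁

/-! ### The coupling -/

/-- The weak `L^p` quantity `sup_{t > 0} t λ(|f| > t)^{1/p}`. -/
def weakLpNorm (p : ℝ) (f : Space3 → ℝ) : ℝ≥0∞ :=
  ⨆ (t : ℝ) (_ : 0 < t), volume {k | t < |f k|} ^ (1 / p) * ENNReal.ofReal t

/-- Membership in the Lorentz space `L^{p,∞}`. -/
def MemWeakLp (p : ℝ) (f : Space3 → ℝ) : Prop :=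
  AEStronglyMeasurable f volume ∧ weakLpNorm p f < ∞

/-- The function `W = g² ω⁻¹ v²`, with values in `[0, ∞]`; here `c / 0 = ∞` for `c > 0`
and `0 / 0 = 0`. -/
def couplingWeight (g : ℝ) (ω v : Space3 → ℝ) (k : Space3) : ℝ≥0∞ :=
  ENNReal.ofReal (g ^ 2 * v k ^ 2) / ENNReal.ofReal (ω k)

/-- The condition on the coupling: `W = g² ω⁻¹ v²` belongs to `L¹ + L^{3,∞}` (in particular it is
almost everywhere finite). -/
def CouplingCondition (g : ℝ) (ω v : Space3 → ℝ) : Prop :=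
  ∃ W₁ W₂ : Space3 → ℝ, Integrable W₁ ∧ MemWeakLp 3 W₂ ∧
    ∀ᵐ k, couplingWeight g ω v k ≠ ∞ ∧ (couplingWeight g ω v k).toReal = W₁ k + W₂ k

/-- The coupling function with an ultraviolet cutoff, `v_Λ = v 1_{|k| ≤ Λ}`. -/
def cutoff (Λ : ℝ) (v : Space3 → ℝ) : Space3 → ℝ :=
  Set.indicator {k | ‖k‖ ≤ Λ} v

/-! ### The energy functional -/

/-- The electronic states: normalized elements of `Q_V`. -/
def electronStates (V : Space3 → ℝ) : Set L2 := {u | u ∈ formDomain V ∧ ‖u‖ = 1}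

/-- The field states `Z_ω`: measurable `f` with `ω^{1/2} f` square-integrable. -/
def fieldStates (ω : Space3 → ℝ) : Set (Space3 → ℂ) :=
  {f | Measurable f ∧ MemLp (fun k => (√(ω k) : ℂ) * f k) 2 volume}

/-- The function `k ↦ ∫ e^{ikx} |u(x)|² dx`. -/
def densityFourier (u : L2) (k : Space3) : ℂ :=
  ∫ x, Complex.exp (Complex.I * (inner ℝ k x : ℝ)) * ((‖u x‖ ^ 2 : ℝ) : ℂ)

/-- The Klein--Gordon--Schrödinger energy. The interaction is the iterated integral
`∫ v(k) f(k) (∫ e^{ikx} |u(x)|² dx) dk`. -/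
def energy (V : Space3 → ℝ) (g : ℝ) (ω v : Space3 → ℝ) (u : L2) (f : Space3 → ℂ) : ℝ :=
  kinetic u + (∫ x, V x * ‖u x‖ ^ 2) + (∫ k, ω k * ‖f k‖ ^ 2)
    + 2 * g * (∫ k, (v k : ℂ) * f k * densityFourier u k).re

/-- The infimum of the energy over all states, with values in `[-∞, ∞]`. -/
def groundEnergy (V : Space3 → ℝ) (g : ℝ) (ω v : Space3 → ℝ) : EReal :=
  ⨅ u ∈ electronStates V, ⨅ f ∈ fieldStates ω, ((energy V g ω v u f : ℝ) : EReal)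

end KGS

end

noncomputable section

open scoped FourierTransform SchwartzMap InnerProductSpace

namespace KGS

/-! Every cut-off infimum lies above the limit: replacing `f` by its restriction to `|k| ≤ Λ` leaves
the cut-off interaction unchanged and can only lower the field energy. Conversely, if the infimum is
below `b`, some fixed state has energy below `b`. Its cut-off energies converge by dominated
convergence, hence are eventually below `b`. No minimizer or lower bound on the energy enters.

The analytic content is `integrable_interaction`. Since `2|g v f ρ̂|` is at most `W|ρ̂|² + ω|f|²`,
it suffices that `W|ρ̂|²` be integrable, where `ρ = |u|²`. For `u` in `H¹`, `ρ̂` is bounded and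
square-integrable, being an autocorrelation of `û = A h` with `A` in `L⁴` and `h` in `L²`.
Boundedness handles `W₁` and the part of `W₂` above height one, which is integrable;
square-integrability handles the rest. -/

/-! ### Removing the cutoff from the infimum -/

/-- Restricting the field to `|k| ≤ Λ` does not increase the cut-off energy, and turns it into the
energy without cutoff. -/
theorem energy_indicator_le (V : Space3 → ℝ) (g : ℝ) {ω : Space3 → ℝ} (v : Space3 → ℝ)
    (hω_nonneg : ∀ k, 0 ≤ ω k) (u : L2) {f : Space3 → ℂ}
    (hf : Integrable fun k => ω k * ‖f k‖ ^ 2) (Λ : ℝ) :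
    energy V g ω v u ({k | ‖k‖ ≤ Λ}.indicator f) ≤ energy V g ω (cutoff Λ v) u f := by
  have hint : (fun k => (v k : ℂ) * ({k | ‖k‖ ≤ Λ}.indicator f) k * densityFourier u k)
      = fun k => (cutoff Λ v k : ℂ) * f k * densityFourier u k := by
    funext k
    by_cases hk : ‖k‖ ≤ Λ <;> simp [cutoff, hk]
  have hfield : ∫ k, ω k * ‖({k | ‖k‖ ≤ Λ}.indicator f) k‖ ^ 2 ≤ ∫ k, ω k * ‖f k‖ ^ 2 := by
    refine integral_mono_of_nonneg (ae_of_all _ fun k => ?_) hf (ae_of_all _ fun k => ?_)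
    · exact mul_nonneg (hω_nonneg k) (sq_nonneg _)
    · exact mul_le_mul_of_nonneg_left
        (pow_le_pow_left₀ (norm_nonneg _) (norm_indicator_le_norm_self f k) 2) (hω_nonneg k)
  unfold energy
  rw [hint]
  linarith

theorem integrable_field_energy {ω : Space3 → ℝ} (hω_nonneg : ∀ k, 0 ≤ ω k)
    {f : Space3 → ℂ} (hf : f ∈ fieldStates ω) : Integrable fun k => ω k * ‖f k‖ ^ 2 := by
  refine (hf.2.integrable_norm_pow two_ne_zero).congr (ae_of_all _ fun k => ?_)
  simp only [norm_mul, Complex.norm_real, mul_pow, Real.norm_eq_abs, sq_abs]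
  rw [Real.sq_sqrt (hω_nonneg k)]

theorem indicator_mem_fieldStates {ω : Space3 → ℝ} {f : Space3 → ℂ} (hf : f ∈ fieldStates ω)
    (Λ : ℝ) : {k | ‖k‖ ≤ Λ}.indicator f ∈ fieldStates ω := by
  have hs : MeasurableSet {k : Space3 | ‖k‖ ≤ Λ} := measurableSet_le measurable_norm measurable_const
  refine ⟨hf.1.indicator hs, ?_⟩
  have : (fun k => (√(ω k) : ℂ) * ({k | ‖k‖ ≤ Λ}.indicator f) k)
      = {k | ‖k‖ ≤ Λ}.indicator fun k => (√(ω k) : ℂ) * f k := by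
    funext k
    by_cases hk : ‖k‖ ≤ Λ <;> simp [hk]
  rw [this]
  exact hf.2.indicator hs

/-- For a fixed state with integrable interaction the cutoff can be removed. -/
theorem tendsto_energy_cutoff (V : Space3 → ℝ) (g : ℝ) (ω v : Space3 → ℝ) (u : L2)
    (f : Space3 → ℂ)
    (hint : Integrable fun k => ((g * v k : ℝ) : ℂ) * f k * densityFourier u k) :
    Tendsto (fun Λ => energy V g ω (cutoff Λ v) u f) atTop (𝓝 (energy V g ω v u f)) := by
  -- The factor `g` is kept inside the integral: when `g = 0` nothing makes the integrand without it
  -- integrable.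
  have key : ∀ w : Space3 → ℝ, 2 * g * (∫ k, (w k : ℂ) * f k * densityFourier u k).re
      = 2 * (∫ k, ((g * w k : ℝ) : ℂ) * f k * densityFourier u k).re := by
    intro w
    have : (fun k => ((g * w k : ℝ) : ℂ) * f k * densityFourier u k)
        = fun k => (g : ℂ) * ((w k : ℂ) * f k * densityFourier u k) := by
      funext k; push_cast; ring
    rw [this, integral_const_mul, Complex.re_ofReal_mul]
    ring
  have hind : ∀ Λ, (fun k => ((g * cutoff Λ v k : ℝ) : ℂ) * f k * densityFourier u k)
      = {k | ‖k‖ ≤ Λ}.indicator fun k => ((g * v k : ℝ) : ℂ) * f k * densityFourier u k := by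
    intro Λ
    funext k
    by_cases hk : ‖k‖ ≤ Λ <;> simp [cutoff, hk]
  have hlim : Tendsto
      (fun Λ => ∫ k, ((g * cutoff Λ v k : ℝ) : ℂ) * f k * densityFourier u k) atTop
      (𝓝 (∫ k, ((g * v k : ℝ) : ℂ) * f k * densityFourier u k)) := by
    simp_rw [hind]
    refine tendsto_integral_filter_of_dominated_convergence _
      (Eventually.of_forall fun Λ => ?_) (Eventually.of_forall fun Λ => ae_of_all _ fun k => ?_)
      hint.norm (ae_of_all _ fun k => ?_)
    · exact hint.1.indicator (measurableSet_le measurable_norm measurable_const)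
    · exact norm_indicator_le_norm_self _ k
    · refine tendsto_const_nhds.congr' ?_
      filter_upwards [eventually_ge_atTop ‖k‖] with Λ hΛ
      simp [hΛ]
  simp only [energy, key]
  exact tendsto_const_nhds.add
    (tendsto_const_nhds.mul ((Complex.continuous_re.tendsto _).comp hlim))

/-- If the interaction converges absolutely on all states, the ground state energy is the
ultraviolet limit of the cut-off ones. -/
theorem tendsto_groundEnergy_cutoff (V : Space3 → ℝ) (g : ℝ) {ω : Space3 → ℝ} (v : Space3 → ℝ)
    (hω_nonneg : ∀ k, 0 ≤ ω k)
    (hint : ∀ u ∈ electronStates V, ∀ f ∈ fieldStates ω,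
      Integrable fun k => ((g * v k : ℝ) : ℂ) * f k * densityFourier u k) :
    Tendsto (fun Λ : ℝ => groundEnergy V g ω (cutoff Λ v)) atTop
      (𝓝 (groundEnergy V g ω v)) := by
  refine tendsto_order.2 ⟨fun a ha => Eventually.of_forall fun Λ => ha.trans_le ?_, fun b hb => ?_⟩
  · refine le_iInf₂ fun u hu => le_iInf₂ fun f hf => ?_
    refine (iInf₂_le_of_le u hu
      (iInf₂_le _ (indicator_mem_fieldStates hf Λ))).trans ?_
    exact EReal.coe_le_coe_iff.2
      (energy_indicator_le V g v hω_nonneg u (integrable_field_energy hω_nonneg hf) Λ)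
  · obtain ⟨u, hb⟩ := iInf_lt_iff.1 hb
    obtain ⟨hu, hb⟩ := iInf_lt_iff.1 hb
    obtain ⟨f, hb⟩ := iInf_lt_iff.1 hb
    obtain ⟨hf, hb⟩ := iInf_lt_iff.1 hb
    have hlim := (continuous_coe_real_ereal.tendsto _).comp
      (tendsto_energy_cutoff V g ω v u f (hint u hu f hf))
    filter_upwards [hlim.eventually_lt_const hb] with Λ hΛ
    exact (iInf₂_le_of_le u hu (iInf₂_le f hf)).trans_lt hΛ


/-! ### The Fourier transform of the density as an autocorrelation -/

/-- Multiplication of square-integrable functions by the plane wave `x ↦ e^{ikx}`. -/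
def modulation (k : Space3) : L2 →L[ℂ] L2 :=
  (ContinuousLinearMap.lsmul ℂ ℂ).holderL volume ∞ 2 2
    (BoundedContinuousFunction.innerProbChar k).memLp_top.toLp

theorem coeFn_modulation (k : Space3) (u : L2) :
    modulation k u =ᵐ[volume] fun x => Complex.exp (Complex.I * (inner ℝ k x : ℝ)) * u x := by
  have h₁ := (ContinuousLinearMap.lsmul ℂ ℂ (E := ℂ)).coeFn_holder (r := 2)
    ((BoundedContinuousFunction.innerProbChar k).memLp_top.toLp) u
  have h₂ := ((BoundedContinuousFunction.innerProbChar k).memLp_top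
    (μ := (volume : Measure Space3))).coeFn_toLp
  filter_upwards [h₁, h₂] with x hx₁ hx₂
  refine hx₁.trans ?_
  rw [hx₂, BoundedContinuousFunction.innerProbChar_apply, real_inner_comm, mul_comm Complex.I]
  rfl

/-- Translation of square-integrable functions by `ξ`. -/
def translation (ξ : Space3) : L2 →ₗᵢ[ℂ] L2 :=
  Lp.compMeasurePreservingₗᵢ ℂ (fun p : Space3 => p - ξ) (measurePreserving_sub_right volume ξ)

theorem coeFn_translation (ξ : Space3) (F : L2) :
    translation ξ F =ᵐ[volume] fun p => F (p - ξ) :=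
  Lp.coeFn_compMeasurePreserving F (measurePreserving_sub_right volume ξ)

/-- The inverse Fourier transform turns translations into modulations. -/
theorem fourierInv_translation (ξ : Space3) (F : L2) :
    𝓕⁻ (translation ξ F) = modulation ((2 * Real.pi) • ξ) (𝓕⁻ F) := by
  refine DenseRange.induction_on
    (p := fun F : L2 => 𝓕⁻ (translation ξ F) = modulation ((2 * Real.pi) • ξ) (𝓕⁻ F))
    (SchwartzMap.denseRange_toLpCLM (p := 2) ENNReal.ofNat_ne_top) F ?_ fun f => ?_
  · have hF : Continuous fun G : L2 => (𝓕⁻ G : L2) :=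
      (Lp.fourierTransformₗᵢ Space3 ℂ).symm.continuous
    exact isClosed_eq (hF.comp (translation ξ).continuous)
      ((modulation ((2 * Real.pi) • ξ)).continuous.comp hF)
  · have htr : translation ξ (f.toLp 2) = (f.compSubConstCLM ℂ ξ).toLp 2 := by
      refine Lp.ext ?_
      have hf := (measurePreserving_sub_right (volume : Measure Space3) ξ).quasiMeasurePreserving.ae_eq_comp
        (f.coeFn_toLp 2 volume)
      filter_upwards [coeFn_translation ξ (f.toLp 2), hf,
        (f.compSubConstCLM ℂ ξ).coeFn_toLp 2 volume] with p h₁ h₂ h₃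
      rw [h₁, h₃]
      exact h₂
    simp only [SchwartzMap.toLpCLM_apply]
    rw [htr, SchwartzMap.toLp_fourierInv_eq, SchwartzMap.toLp_fourierInv_eq]
    refine Lp.ext ?_
    filter_upwards [coeFn_modulation ((2 * Real.pi) • ξ) ((𝓕⁻ f).toLp 2),
      (𝓕⁻ f).coeFn_toLp 2 volume,
      (𝓕⁻ (f.compSubConstCLM ℂ ξ)).coeFn_toLp 2 volume] with x h₁ h₂ h₃
    rw [h₁, h₂, h₃, SchwartzMap.fourierInv_coe, SchwartzMap.fourierInv_coe,
      Real.fourierInv_eq', Real.fourierInv_eq', ← integral_const_mul]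
    -- Substituting `p - ξ` for `p` pulls the plane wave out of the inversion integral.
    refine Eq.trans (integral_congr_ae (ae_of_all _ fun p => ?_))
      (integral_sub_right_eq_self (μ := (volume : Measure Space3)) _ ξ)
    simp only [SchwartzMap.compSubConstCLM_apply, smul_eq_mul]
    rw [← mul_assoc, ← Complex.exp_add]
    congr 2
    rw [inner_sub_left, inner_smul_left]
    push_cast
    simp
    ring

theorem densityFourier_eq_inner (u : L2) (k : Space3) :
    densityFourier u k = ⟪u, modulation k u⟫_ℂ := by
  rw [L2.inner_def]
  refine integral_congr_ae ?_
  filter_upwards [coeFn_modulation k u] with x hx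
  rw [hx, RCLike.inner_apply, mul_assoc, Complex.mul_conj, Complex.normSq_eq_norm_sq]

/-- By Plancherel, applied to `u` and its modulation, whose Fourier transform is a translate of `𝓕
u`. The factor `2π` reconciles `e^{ikx}` with the normalization of `𝓕`. -/
theorem densityFourier_eq_integral (u : L2) (ξ : Space3) :
    densityFourier u ((2 * Real.pi) • ξ)
      = ∫ p, (𝓕 u : L2) (p - ξ) * starRingEnd ℂ ((𝓕 u : L2) p) := by
  have h : modulation ((2 * Real.pi) • ξ) u = 𝓕⁻ (translation ξ (𝓕 u)) := by
    rw [fourierInv_translation, FourierTransform.fourierInv_fourier_eq]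
  rw [densityFourier_eq_inner, h, ← Lp.inner_fourier_eq,
    FourierTransform.fourier_fourierInv_eq, L2.inner_def]
  refine integral_congr_ae ?_
  filter_upwards [coeFn_translation ξ (𝓕 u)] with p hp
  rw [hp, RCLike.inner_apply]

theorem continuous_densityFourier (u : L2) : Continuous (densityFourier u) := by
  refine continuous_of_dominated (bound := fun x => ‖u x‖ ^ 2) (fun k => ?_)
    (fun k => ae_of_all _ fun x => ?_) ((Lp.memLp u).integrable_norm_pow two_ne_zero)
    (ae_of_all _ fun x => by fun_prop)
  · have hu := (Lp.aestronglyMeasurable u).norm.pow 2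
    exact (Continuous.aestronglyMeasurable (by fun_prop)).mul
      (Complex.continuous_ofReal.comp_aestronglyMeasurable hu)
  · rw [norm_mul, mul_comm Complex.I, Complex.norm_exp_ofReal_mul_I, one_mul, Complex.norm_real,
      Real.norm_of_nonneg (sq_nonneg _)]

theorem norm_densityFourier_le (u : L2) (k : Space3) : ‖densityFourier u k‖ ≤ ‖u‖ ^ 2 := by
  have hmod : ‖modulation k u‖ = ‖u‖ := by
    rw [Lp.norm_def, Lp.norm_def]
    congr 1
    refine eLpNorm_congr_norm_ae ?_
    filter_upwards [coeFn_modulation k u] with x hx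
    rw [hx, norm_mul, mul_comm Complex.I, Complex.norm_exp_ofReal_mul_I, one_mul]
  rw [densityFourier_eq_inner, sq]
  simpa only [hmod] using norm_inner_le_norm (𝕜 := ℂ) u (modulation k u)

/-! ### Square-integrability of the transformed density -/

theorem exists_fourier_eq_of_mem_H1 {u : L2} (hu : u ∈ H1) :
    ∃ h : L2, (𝓕 u : L2) =ᵐ[volume] fun p => (((1 + ‖p‖ ^ 2) ^ (-(1:ℝ) / 2) : ℝ) : ℂ) * h p := by
  obtain ⟨h, hh⟩ := TemperedDistribution.memSobolev_iff_exists_smulLeftCLM_fourier.1 hu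
  refine ⟨h, ?_⟩
  set a : Space3 → ℂ := fun p => (((1 + ‖p‖ ^ 2) ^ (-(1:ℝ) / 2) : ℝ) : ℂ) with ha
  have hatg : a.HasTemperateGrowth := by fun_prop
  have hab : MemLp a ∞ := by
    refine memLp_top_of_bound hatg.1.continuous.aestronglyMeasurable 1 (ae_of_all _ fun p => ?_)
    rw [ha, Complex.norm_real, Real.norm_of_nonneg (by positivity)]
    exact Real.rpow_le_one_of_one_le_of_nonpos (by simp) (by norm_num)
  -- Compared as tempered distributions, where the weights of exponents `1/2` and `-1/2` cancel.
  have heq : (𝓕 u : L2) = (hab.toLp a • h : L2) := by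
    have hinj := LinearMap.ker_eq_bot.1
      (Lp.ker_toTemperedDistributionCLM_eq_bot (E := Space3) (F := ℂ) (p := 2) (μ := volume))
    refine hinj ?_
    change ((𝓕 u : L2) : TemperedDistribution Space3 ℂ)
      = ((hab.toLp a • h : L2) : TemperedDistribution Space3 ℂ)
    rw [Lp.toTemperedDistribution_smul_eq hatg hab, ← hh,
      TemperedDistribution.smulLeftCLM_smulLeftCLM_apply (by fun_prop) hatg,
      Lp.fourier_toTemperedDistribution_eq]
    have hone : (fun p : Space3 => (((1 + ‖p‖ ^ 2) ^ ((1:ℝ) / 2) : ℝ) : ℂ)) * a = fun _ => 1 := by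
      funext p
      rw [Pi.mul_apply, ha, ← Complex.ofReal_mul, ← Real.rpow_add (by positivity)]
      norm_num
    rw [hone, TemperedDistribution.smulLeftCLM_const, one_smul]
  rw [heq]
  filter_upwards [Lp.coeFn_lpSMul (r := 2) (hab.toLp a) h, hab.coeFn_toLp] with p h₁ h₂
  rw [h₁, Pi.smul_apply', h₂, smul_eq_mul]

theorem lintegral_mul_sq_le {α : Type*} [MeasurableSpace α] {μ : Measure α} {f g : α → ℝ≥0∞}
    (hf : AEMeasurable f μ) (hg : AEMeasurable g μ) :
    (∫⁻ x, f x * g x ∂μ) ^ 2 ≤ (∫⁻ x, f x ^ 2 ∂μ) * ∫⁻ x, g x ^ 2 ∂μ := by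
  have h := ENNReal.lintegral_mul_le_Lp_mul_Lq μ Real.HolderConjugate.two_two hf hg
  simp only [Pi.mul_apply, ENNReal.rpow_two] at h
  refine (pow_le_pow_left₀ zero_le h 2).trans_eq ?_
  rw [mul_pow, ← ENNReal.rpow_two, ← ENNReal.rpow_two, ← ENNReal.rpow_mul, ← ENNReal.rpow_mul]
  norm_num

/-- The autocorrelation of `A * H` is square-integrable when `A` is in `L⁴` and `H` in `L²`. -/
theorem lintegral_autocorrelation_sq_le {A H : Space3 → ℝ≥0∞} (hA : Measurable A)
    (hH : Measurable H) :
    ∫⁻ ξ, (∫⁻ p, (A (p - ξ) * H (p - ξ)) * (A p * H p)) ^ 2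
      ≤ (∫⁻ p, A p ^ 4) * (∫⁻ p, H p ^ 2) ^ 2 := by
  -- Cauchy–Schwarz and translation invariance bound the square of the left side by the square of
  -- the right.
  have hA4 : ∀ ξ, ∫⁻ p, (A (p - ξ) * A p) ^ 2 ≤ ∫⁻ p, A p ^ 4 := by
    intro ξ
    have h := lintegral_mul_sq_le (μ := (volume : Measure Space3))
      (f := fun p => A (p - ξ) ^ 2) (g := fun p => A p ^ 2)
      (by fun_prop) (by fun_prop)
    simp only [← pow_mul, Nat.reduceMul] at h
    rw [lintegral_sub_right_eq_self (fun p => A p ^ 4) ξ, ← sq] at h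
    simp only [mul_pow]
    exact (ENNReal.pow_le_pow_left_iff two_ne_zero).1 h
  calc ∫⁻ ξ, (∫⁻ p, (A (p - ξ) * H (p - ξ)) * (A p * H p)) ^ 2
      ≤ ∫⁻ ξ, (∫⁻ p, A p ^ 4) * ∫⁻ p, (H (p - ξ) * H p) ^ 2 := by
        refine lintegral_mono fun ξ => ?_
        have h := lintegral_mul_sq_le (μ := (volume : Measure Space3))
          (f := fun p => A (p - ξ) * A p) (g := fun p => H (p - ξ) * H p)
          (by fun_prop) (by fun_prop)
        simp only [mul_mul_mul_comm] at h ⊢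
        exact h.trans (mul_le_mul_left (hA4 ξ) _)
    _ = (∫⁻ p, A p ^ 4) * ∫⁻ p, (∫⁻ ξ, H (p - ξ) ^ 2) * H p ^ 2 := by
        rw [lintegral_const_mul _ (by fun_prop), lintegral_lintegral_swap (by fun_prop)]
        simp only [mul_pow]
        congr 1
        refine lintegral_congr fun p => ?_
        rw [lintegral_mul_const _ (by fun_prop)]
    _ = (∫⁻ p, A p ^ 4) * (∫⁻ p, H p ^ 2) ^ 2 := by
        simp only [lintegral_sub_left_eq_self (fun p => H p ^ 2)]
        rw [lintegral_const_mul _ (by fun_prop), sq]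

/-- The weight `(1 + |p|²)^{-1/2}` is in `L⁴` because `4 > 3`, so the autocorrelation estimate
applies to `𝓕 u`. -/
theorem integrable_norm_densityFourier_sq {u : L2} (hu : u ∈ H1) :
    Integrable fun k => ‖densityFourier u k‖ ^ 2 := by
  obtain ⟨h, hh⟩ := exists_fourier_eq_of_mem_H1 hu
  obtain ⟨h', hh'm, hh'⟩ := (Lp.aestronglyMeasurable h).aemeasurable
  set A : Space3 → ℝ≥0∞ := fun p => ENNReal.ofReal ((1 + ‖p‖ ^ 2) ^ (-(1:ℝ) / 2)) with hAdef
  set H : Space3 → ℝ≥0∞ := fun p => ‖h' p‖ₑ with hHdef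
  have hA : Measurable A := by
    have : Continuous fun p : Space3 => (1 + ‖p‖ ^ 2) ^ (-(1:ℝ) / 2) :=
      Continuous.rpow_const (by fun_prop) fun p => Or.inl (by positivity)
    exact this.measurable.ennreal_ofReal
  have hH : Measurable H := hh'm.enorm
  have hAH : ∀ᵐ p, ‖(𝓕 u : L2) p‖ₑ = A p * H p := by
    filter_upwards [hh, hh'] with p h₁ h₂
    rw [h₁, enorm_mul, h₂, hAdef, hHdef]
    congr 1
    rw [← ofReal_norm, Complex.norm_real, Real.norm_of_nonneg (by positivity)]
  have hAfin : ∫⁻ p, A p ^ 4 < ∞ := by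
    have hint := integrable_rpow_neg_one_add_norm_sq (E := Space3) (μ := volume) (r := 4)
      (by simp; norm_num)
    refine lt_of_eq_of_lt (lintegral_congr fun p => ?_) hint.lintegral_lt_top
    rw [hAdef, ← ENNReal.ofReal_pow (by positivity), ← Real.rpow_natCast,
      ← Real.rpow_mul (by positivity)]
    norm_num
  have hHfin : ∫⁻ p, H p ^ 2 < ∞ := by
    have hint := (Lp.memLp h).integrable_norm_pow two_ne_zero
    refine lt_of_eq_of_lt (lintegral_congr_ae ?_) hint.lintegral_lt_top
    filter_upwards [hh'] with p hp
    simp only [hHdef]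
    rw [← hp, ← ofReal_norm, ENNReal.ofReal_pow (norm_nonneg _)]
  have hbound : ∀ ξ, ‖densityFourier u ((2 * Real.pi) • ξ)‖ₑ
      ≤ ∫⁻ p, (A (p - ξ) * H (p - ξ)) * (A p * H p) := by
    intro ξ
    rw [densityFourier_eq_integral]
    refine (enorm_integral_le_lintegral_enorm _).trans_eq (lintegral_congr_ae ?_)
    filter_upwards [hAH, (measurePreserving_sub_right (volume : Measure Space3)
      ξ).quasiMeasurePreserving.ae hAH] with p h₁ h₂
    rw [enorm_mul, h₂, RCLike.enorm_conj, h₁]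
  have hscaled : Integrable fun ξ : Space3 => ‖densityFourier u ((2 * Real.pi) • ξ)‖ ^ 2 := by
    have hcont : Continuous fun ξ : Space3 => ‖densityFourier u ((2 * Real.pi) • ξ)‖ ^ 2 :=
      ((continuous_densityFourier u).comp (continuous_const_smul _)).norm.pow 2
    refine ⟨hcont.aestronglyMeasurable, ?_⟩
    rw [hasFiniteIntegral_iff_enorm]
    calc ∫⁻ ξ, ‖‖densityFourier u ((2 * Real.pi) • ξ)‖ ^ 2‖ₑ
        ≤ ∫⁻ ξ, (∫⁻ p, (A (p - ξ) * H (p - ξ)) * (A p * H p)) ^ 2 := by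
          refine lintegral_mono fun ξ => ?_
          rw [enorm_pow, enorm_norm]
          exact pow_le_pow_left₀ zero_le (hbound ξ) 2
      _ ≤ (∫⁻ p, A p ^ 4) * (∫⁻ p, H p ^ 2) ^ 2 := lintegral_autocorrelation_sq_le hA hH
      _ < ∞ := ENNReal.mul_lt_top hAfin (ENNReal.pow_lt_top hHfin)
  exact (integrable_comp_smul_iff volume (fun k => ‖densityFourier u k‖ ^ 2)
    (by positivity : (2 * Real.pi) ≠ 0)).1 hscaled


/-! ### Weak Lebesgue spaces and convergence of the interaction -/

theorem volume_lt_le_of_weakLpNorm {p : ℝ} (hp : 0 < p) (f : Space3 → ℝ) {t : ℝ} (ht : 0 < t) :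
    volume {k | t < |f k|} ≤ weakLpNorm p f ^ p * ENNReal.ofReal (t ^ (-p)) := by
  have h : volume {k | t < |f k|} ^ (1 / p) * ENNReal.ofReal t ≤ weakLpNorm p f :=
    le_iSup₂ (f := fun (t : ℝ) (_ : 0 < t) =>
      volume {k | t < |f k|} ^ (1 / p) * ENNReal.ofReal t) t ht
  have h' := ENNReal.rpow_le_rpow h hp.le
  rw [ENNReal.mul_rpow_of_nonneg _ _ hp.le, ← ENNReal.rpow_mul, one_div_mul_cancel hp.ne',
    ENNReal.rpow_one] at h'
  have ht' : ENNReal.ofReal t ≠ 0 := by simpa using ht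
  rw [← ENNReal.ofReal_rpow_of_pos ht, ENNReal.rpow_neg, ← div_eq_mul_inv]
  exact (ENNReal.le_div_iff_mul_le (Or.inl (by simp [ht]))
    (Or.inl (by simp [hp.le]))).2 h'

/-- The part of a weak `Lᵖ` function above height one is integrable when `p > 1`. -/
theorem integrable_indicator_of_memWeakLp {p : ℝ} (hp : 1 < p) {f : Space3 → ℝ}
    (hf : MemWeakLp p f) : Integrable ({k | 1 < |f k|}.indicator fun k => |f k|) := by
  have hp0 : 0 < p := one_pos.trans hp
  have hm : AEMeasurable ({k | 1 < |f k|}.indicator fun k => |f k|) :=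
    AEMeasurable.indicator₀ (hf.1.norm.aemeasurable)
      (nullMeasurableSet_lt aemeasurable_const hf.1.norm.aemeasurable)
  have hnn : 0 ≤ ({k | 1 < |f k|}.indicator fun k => |f k|) :=
    fun k => Set.indicator_nonneg (fun _ _ => abs_nonneg _) k
  refine ⟨hm.aestronglyMeasurable, ?_⟩
  rw [hasFiniteIntegral_iff_ofReal (ae_of_all _ hnn),
    lintegral_eq_lintegral_meas_lt _ (ae_of_all _ hnn) hm]
  set C := weakLpNorm p f ^ p with hC
  have hCfin : C < ∞ := ENNReal.rpow_lt_top_of_nonneg hp0.le hf.2.ne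
  -- In the layer-cake integral, `s = 1` serves the heights `t ≤ 1` and `s = t` the heights above,
  -- where `t^{-p}` is integrable.
  have hsub : ∀ s t : ℝ, s = 1 ∨ s = t →
      {k | t < ({k | 1 < |f k|}.indicator fun k => |f k|) k} ∩ {_k | 0 < t}
        ⊆ {k | s < |f k|} := by
    rintro s t hs k ⟨hk, ht : 0 < t⟩
    by_cases h1 : 1 < |f k|
    · rcases hs with rfl | rfl
      · exact h1
      · simpa [h1] using hk
    · simp only [Set.mem_ofPred_eq, h1, not_false_eq_true, Set.indicator_of_notMem] at hk
      exact absurd hk ht.not_gt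
  have hle : ∀ s t : ℝ, 0 < t → 0 < s → (s = 1 ∨ s = t) →
      volume {k | t < ({k | 1 < |f k|}.indicator fun k => |f k|) k}
        ≤ C * ENNReal.ofReal (s ^ (-p)) := by
    intro s t ht hs hst
    refine le_trans (measure_mono fun k hk => ?_) (volume_lt_le_of_weakLpNorm hp0 f hs)
    exact hsub s t hst ⟨hk, ht⟩
  rw [← Set.Ioc_union_Ioi_eq_Ioi zero_le_one,
    lintegral_union measurableSet_Ioi (Set.Ioc_disjoint_Ioi le_rfl)]
  refine ENNReal.add_lt_top.2 ⟨?_, ?_⟩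
  · calc ∫⁻ t in Set.Ioc (0:ℝ) 1, volume {k | t < ({k | 1 < |f k|}.indicator fun k => |f k|) k}
        ≤ ∫⁻ _ in Set.Ioc (0:ℝ) 1, C * ENNReal.ofReal (1 ^ (-p)) :=
          setLIntegral_mono measurable_const fun t ht => hle 1 t ht.1 one_pos (Or.inl rfl)
      _ < ∞ := by
          rw [setLIntegral_const]
          exact ENNReal.mul_lt_top (ENNReal.mul_lt_top hCfin ENNReal.ofReal_lt_top) (by simp)
  · calc ∫⁻ t in Set.Ioi (1:ℝ), volume {k | t < ({k | 1 < |f k|}.indicator fun k => |f k|) k}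
        ≤ ∫⁻ t in Set.Ioi (1:ℝ), C * ENNReal.ofReal (t ^ (-p)) :=
          setLIntegral_mono (by fun_prop) fun t ht =>
            hle t t (one_pos.trans ht) (one_pos.trans ht) (Or.inr rfl)
      _ < ∞ := by
          rw [lintegral_const_mul _ (by fun_prop)]
          exact ENNReal.mul_lt_top hCfin
            (integrableOn_Ioi_rpow_of_lt (by linarith) one_pos).lintegral_lt_top

/-- Functions in `L¹ + L^{3,∞}` are integrable against `|ρ̂|²`, the density `ρ = |u|²` being that
of a state of finite kinetic energy. -/
theorem integrable_couplingWeight_mul {g : ℝ} {ω v : Space3 → ℝ} (hW : CouplingCondition g ω v)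
    (hω : Measurable ω) (hv : Measurable v) {u : L2} (hu : u ∈ H1) :
    Integrable fun k => (couplingWeight g ω v k).toReal * ‖densityFourier u k‖ ^ 2 := by
  obtain ⟨W₁, W₂, hW₁, hW₂, hW⟩ := hW
  have hρ := integrable_norm_densityFourier_sq hu
  have hWm : Measurable fun k => (couplingWeight g ω v k).toReal := by
    unfold couplingWeight
    fun_prop
  have hbound := ((hW₁.norm.add (integrable_indicator_of_memWeakLp (by norm_num) hW₂)).const_mul
    ((‖u‖ ^ 2) ^ 2)).add hρ
  refine hbound.mono' (hWm.aestronglyMeasurable.mul hρ.1) ?_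
  filter_upwards [hW] with k hk
  have h₁ : ‖densityFourier u k‖ ^ 2 ≤ (‖u‖ ^ 2) ^ 2 :=
    pow_le_pow_left₀ (norm_nonneg _) (norm_densityFourier_le u k) 2
  have h₀ : 0 ≤ ‖densityFourier u k‖ ^ 2 := sq_nonneg _
  have h₂ : |W₂ k| * ‖densityFourier u k‖ ^ 2
      ≤ (‖u‖ ^ 2) ^ 2 * ({k | 1 < |W₂ k|}.indicator fun k => |W₂ k|) k
        + ‖densityFourier u k‖ ^ 2 := by
    by_cases h : 1 < |W₂ k|
    · simp only [Set.mem_ofPred_eq, h, Set.indicator_of_mem]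
      nlinarith [mul_le_mul_of_nonneg_left h₁ (abs_nonneg (W₂ k))]
    · simp only [Set.mem_ofPred_eq, h, not_false_eq_true, Set.indicator_of_notMem, mul_zero,
        zero_add]
      exact mul_le_of_le_one_left h₀ (not_lt.1 h)
  simp only [Pi.add_apply, norm_mul, norm_pow, hk.2, Real.norm_eq_abs, abs_norm]
  calc |W₁ k + W₂ k| * ‖densityFourier u k‖ ^ 2
      ≤ (|W₁ k| + |W₂ k|) * ‖densityFourier u k‖ ^ 2 :=
        mul_le_mul_of_nonneg_right (abs_add_le _ _) h₀
    _ ≤ _ := by nlinarith [mul_le_mul_of_nonneg_left h₁ (abs_nonneg (W₁ k))]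

/-- The interaction integral converges absolutely on all states. -/
theorem integrable_interaction {g : ℝ} {ω v : Space3 → ℝ} (hω : Measurable ω)
    (hω_nonneg : ∀ k, 0 ≤ ω k) (hv : Measurable v) (hW : CouplingCondition g ω v) {u : L2}
    (hu : u ∈ H1) {f : Space3 → ℂ} (hf : f ∈ fieldStates ω) :
    Integrable fun k => ((g * v k : ℝ) : ℂ) * f k * densityFourier u k := by
  have hρ := (continuous_densityFourier u).measurable
  have hfm := hf.1
  have hmeas : Measurable fun k => ((g * v k : ℝ) : ℂ) * f k * densityFourier u k := by
    fun_prop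
  refine ((integrable_couplingWeight_mul hW hω hv hu).add
    (integrable_field_energy hω_nonneg hf)).mono' hmeas.aestronglyMeasurable ?_
  obtain ⟨_, _, _, _, hW⟩ := hW
  filter_upwards [hW] with k hk
  -- Where `ω` vanishes, finiteness of the weight forces `g v = 0`, so the identity survives.
  have hgv : (couplingWeight g ω v k).toReal * ω k = (g * v k) ^ 2 := by
    rcases (hω_nonneg k).eq_or_lt with h0 | hpos
    · have hfin := hk.1
      rw [couplingWeight, ← h0, ENNReal.ofReal_zero] at hfin
      have hz : ENNReal.ofReal (g ^ 2 * v k ^ 2) = 0 := by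
        by_contra hne
        exact hfin (ENNReal.div_zero hne)
      rw [← h0, mul_zero, mul_pow]
      exact le_antisymm (by positivity) (ENNReal.ofReal_eq_zero.1 hz)
    · rw [couplingWeight, ← ENNReal.ofReal_div_of_pos hpos, ENNReal.toReal_ofReal (by positivity)]
      field_simp
  have hnn : 0 ≤ (couplingWeight g ω v k).toReal := ENNReal.toReal_nonneg
  simp only [Pi.add_apply, norm_mul, Complex.norm_real, Real.norm_eq_abs]
  refine abs_le_of_sq_le_sq' ?_ ?_ |>.2
  · set w := (couplingWeight g ω v k).toReal
    have h4 : (|g * v k| * ‖f k‖ * ‖densityFourier u k‖) ^ 2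
        = (w * ‖densityFourier u k‖ ^ 2) * (ω k * ‖f k‖ ^ 2) := by
      rw [mul_pow, mul_pow, sq_abs, ← hgv]; ring
    rw [← abs_mul, h4]
    have hx : 0 ≤ w * ‖densityFourier u k‖ ^ 2 := by positivity
    have hy : 0 ≤ ω k * ‖f k‖ ^ 2 := mul_nonneg (hω_nonneg k) (sq_nonneg _)
    -- With `x` and `y` the two nonnegative factors, this is `x y ≤ (x + y)²`.
    nlinarith [sq_nonneg (w * ‖densityFourier u k‖ ^ 2), sq_nonneg (ω k * ‖f k‖ ^ 2),
      mul_nonneg hx hy]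
  · have hy : 0 ≤ ω k * ‖f k‖ ^ 2 := mul_nonneg (hω_nonneg k) (sq_nonneg _)
    positivity

end KGS

end

theorem proposition1p5 (V : KGS.Space3 → ℝ) (g : ℝ) (ω v : KGS.Space3 → ℝ)
    (hω : Measurable ω) (hω_nonneg : ∀ k, 0 ≤ ω k) (hv : Measurable v)
    (hV : KGS.PotentialCondition V) (hW : KGS.CouplingCondition g ω v) :
    Tendsto (fun Λ : ℝ => KGS.groundEnergy V g ω (KGS.cutoff Λ v)) atTop
      (𝓝 (KGS.groundEnergy V g ω v)) :=
  KGS.tendsto_groundEnergy_cutoff V g v hω_nonneg fun _ hu _ hf =>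
    KGS.integrable_interaction hω hω_nonneg hv hW hu.1.1 hf
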